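/- Let $\Gamma$ be a finite simple connected graph with vertex set $X$ and let $x\in X$. Assume that $\Gamma$ is pseudo-distance-regular around $x$: if $\nu$ denotes a positive eigenvector of the adjacency matrix of $\Gamma$, then for every $y\in X$ the three sums $\sum_z \nu_z/\nu_y$, taken over the neighbours $z$ of $y$ with $\partial(x,z)=\partial(x,y)-1$, $\partial(x,z)=\partial(x,y)$, and $\partial(x,z)=\partial(x,y)+1$, respectively, depend only on $\partial(x,y)$. Let $\Sigma$ be a graph isomorphic to the empty graph $S_n$ on $n\ge 2$ vertices, with vertex set $Y$, and let $H=H(\Gamma,\Sigma)$ be the graph obtained from the Cartesian product $\Gamma\,\square\,\Sigma$ by adding a new vertex $w$ adjacent to exactly the vertices $(x,y)$, $y\in Y$. For a base vertex $b$ of a finite connected graph $G$ with vertex set $Z$, let $E_i^*$ be the diagonal $Z\times Z$ matrix with $(z,z)$-entry $1$ if $\partial(b,z)=i$ and $0$ otherwise, and let the Terwilliger algebra $T(b)$ be the subalgebra of $\mathrm{Mat}_Z(\mathbb C)$ generated by the adjacency matrix of $G$ and all $E_i^*$. A $T(b)$-module is a subspace $W\subseteq\mathbb C^Z$ with $T(b)W\subseteq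 W$; it is irreducible if it is nonzero and contains no $T(b)$-modules other than $0$ and $W$; its endpoint is $\min\{i: E_i^*W\ne 0\}$; it is thin if $\dim E_i^*W\le 1$ for all $i$. Two $T(b)$-modules are isomorphic if there is a linear bijection between them that commutes with the action of every $B\in T(b)$. The shape with respect to $b$ of a walk $[y_0,y_1,\dots,y_j]$ is the word $t_1\cdots t_j$ with $t_k=r,f,\ell$ according to whether $\partial(b,y_k)-\partial(b,y_{k-1})$ equals $1,0,-1$. For vertices $y,z$ of $G$ we write $r^m(y,z)$, $r^m\ell(y,z)$, $r^mf(y,z)$, $\ell r^m(y,z)$ for the numbers of walks from $y$ to $z$ of the respective shape with respect to $b$; subscripts $\Gamma$ (base vertex $x$) and $H$ (base vertex $w$) indicate the graph. Then the following hold. (1) $H$ has, up to isomorphism, exactly one irreducible $T(w)$-module with endpoint $1$, and this module is thin. (2) Let $d$ be the eccentricity of $x$ in $\Gamma$. There exist scalars $\alpha_i,\beta_i\in\mathbb C$ $(0\le i\le d)$ such that for all $0\le i\le d$ and all $z\in X$ with $\partial(x,z)=i$, $$r^{i+1}\ell_\Gamma(x,z)=\alpha_i\, r^i_\Gamma(x,z),\qquad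 r^i f_\Gamma(x,z)=\beta_i\, r^i_\Gamma(x,z).$$ (3) For any such scalars, put $\kappa_i=\alpha_{i-1}$, $\mu_i=0$, $\theta_i=\beta_{i-1}$, $\rho_i=0$ for $1\le i\le d_H$, where $d_H$ is the eccentricity of $w$ in $H$. For a neighbour $v$ of $w$ let $D^i_j(w,v)$ be the set of vertices of $H$ at distance $i$ from $w$ and $j$ from $v$. Then for every $1\le i\le d_H$ and every neighbour $v$ of $w$: (a) for every $z\in D^i_{i+1}(w,v)\cup D^i_i(w,v)$, $\; r^i\ell_H(v,z)=\mu_i\,\ell r^i_H(v,z)$ and $r^{i-1}f_H(v,z)=\rho_i\,\ell r^i_H(v,z)$; (b) for every $z\in D^i_{i-1}(w,v)$, $\; r^i\ell_H(v,z)=\kappa_i\, r^{i-1}_H(v,z)+\mu_i\,\ell r^i_H(v,z)$ and $r^{i-1}f_H(v,z)=\theta_i\, r^{i-1}_H(v,z)+\rho_i\,\ell r^i_H(v,z)$. Moreover, $\rho_i=0$ whenever $D^i_{i+1}(w,v)\neq\emptyset$ for some neighbour $v$ of $w$. -/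

import Mathlib

namespace TerwilligerGraph

universe u v

section Graph

variable {V : Type u} (G : SimpleGraph V) (x : V)

/-- The three symbols occurring in the shape of a walk: raising, flat, lowering. -/
inductive Step : Type
  | r
  | f
  | l

/-- The symbol of one step of a walk from a vertex at distance `m` from the base vertex to a
vertex at distance `n` from it. In a connected graph adjacent vertices have distances from the
base vertex that differ by at most one, so the last case is exactly `n = m - 1`. -/
def stepSymbol (m n : ℕ) : Step :=
  if n = m + 1 then Step.r else if n = m then Step.f else Step.l

/-- The shape of a walk with respect to the base vertex `x`. -/
noncomputable def walkShape : ∀ {y z : V}, G.Walk y z → List Step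
  | _, _, SimpleGraph.Walk.nil => []
  | y, _, SimpleGraph.Walk.cons (v := t) _ p =>
      stepSymbol (G.dist x y) (G.dist x t) :: walkShape p

/-- The number of walks from `y` to `z` of shape `s` with respect to `x`. -/
noncomputable def numWalks (s : List Step) (y z : V) : ℕ :=
  Nat.card {p : G.Walk y z // walkShape G x p = s}

/-- `rPow m y z` is the number of `yz`-walks of shape `r^m` with respect to `x`. -/
noncomputable def rPow (m : ℕ) (y z : V) : ℕ :=
  numWalks G x (List.replicate m Step.r) y z

/-- `rPowL m y z` is the number of `yz`-walks of shape `r^m ℓ` with respect to `x`. -/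
noncomputable def rPowL (m : ℕ) (y z : V) : ℕ :=
  numWalks G x (List.replicate m Step.r ++ [Step.l]) y z

/-- `rPowF m y z` is the number of `yz`-walks of shape `r^m f` with respect to `x`. -/
noncomputable def rPowF (m : ℕ) (y z : V) : ℕ :=
  numWalks G x (List.replicate m Step.r ++ [Step.f]) y z

/-- `lRPow m y z` is the number of `yz`-walks of shape `ℓ r^m` with respect to `x`. -/
noncomputable def lRPow (m : ℕ) (y z : V) : ℕ :=
  numWalks G x (Step.l :: List.replicate m Step.r) y z

/-- The cell `D^i_j(x, y)`: vertices at distance `i` from `x` and `j` from `y`. -/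
def distCell (y : V) (i j : ℕ) : Set V :=
  {z | G.dist x z = i ∧ G.dist y z = j}

/-- The scalars `α i`, `β i` with `0 ≤ i ≤ ε(x)` satisfy, for every vertex `z` at distance `i`
from `x`, `r^{i+1}ℓ(x, z) = α i * r^i(x, z)` and `r^i f(x, z) = β i * r^i(x, z)`. -/
def TrivialWalkScalars (α β : ℕ → ℂ) : Prop :=
  ∀ i : ℕ, (i : ℕ∞) ≤ G.eccent x → ∀ z : V, G.dist x z = i →
    (rPowL G x (i + 1) x z : ℂ) = α i * (rPow G x i x z : ℂ) ∧
    (rPowF G x i x z : ℂ) = β i * (rPow G x i x z : ℂ)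

/-- The combinatorial conditions on walks with respect to `x`, with scalars
`κ i`, `μ i`, `θ i`, `ρ i` for `1 ≤ i ≤ ε(x)`. -/
def WalkConditions (κ μ θ ρ : ℕ → ℂ) : Prop :=
  ∀ i : ℕ, 1 ≤ i → (i : ℕ∞) ≤ G.eccent x →
    (∀ y : V, G.Adj x y →
      (∀ z ∈ distCell G x y i (i + 1) ∪ distCell G x y i i,
        (rPowL G x i y z : ℂ) = μ i * (lRPow G x i y z : ℂ) ∧
        (rPowF G x (i - 1) y z : ℂ) = ρ i * (lRPow G x i y z : ℂ)) ∧
      (∀ z ∈ distCell G x y i (i - 1),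
        (rPowL G x i y z : ℂ)
          = κ i * (rPow G x (i - 1) y z : ℂ) + μ i * (lRPow G x i y z : ℂ) ∧
        (rPowF G x (i - 1) y z : ℂ)
          = θ i * (rPow G x (i - 1) y z : ℂ) + ρ i * (lRPow G x i y z : ℂ))) ∧
    ((∃ y : V, G.Adj x y ∧ (distCell G x y i (i + 1)).Nonempty) → ρ i = 0)

open Classical in
/-- Pseudo-distance-regularity around `x` (Fiol and Garriga): the vertices are weighted by the
positive eigenvector `ν` of the adjacency matrix (in a connected graph it is unique up to
scaling, and the quotients below do not depend on the scaling), and the weighted intersection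
numbers of `y` with respect to `x` depend only on the distance from `x` to `y`. -/
def IsPseudoDistanceRegularAround [Fintype V] : Prop :=
  ∃ (ν : V → ℝ) (ev : ℝ), (∀ y, 0 < ν y) ∧ (G.adjMatrix ℝ).mulVec ν = ev • ν ∧
    ∃ c a b : ℕ → ℝ, ∀ y : V,
      (∑ z with G.Adj y z ∧ G.dist x z + 1 = G.dist x y, ν z / ν y) = c (G.dist x y) ∧
      (∑ z with G.Adj y z ∧ G.dist x z = G.dist x y, ν z / ν y) = a (G.dist x y) ∧
      (∑ z with G.Adj y z ∧ G.dist x z = G.dist x y + 1, ν z / ν y) = b (G.dist x y)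

end Graph

section Algebra

variable {V : Type u} [Fintype V] [DecidableEq V] (G : SimpleGraph V) (x : V)

open Classical in
/-- The adjacency matrix over `ℂ`. -/
noncomputable def adjMat : Matrix V V ℂ := G.adjMatrix ℂ

/-- The `i`-th dual idempotent `E_i^*` with respect to `x` (the zero matrix if `i > ε(x)`). -/
noncomputable def dualIdempotent (i : ℕ) : Matrix V V ℂ :=
  Matrix.diagonal fun y => if G.dist x y = i then 1 else 0

/-- The Terwilliger algebra `T(x)`. -/
noncomputable def terwilligerAlgebra : Subalgebra ℂ (Matrix V V ℂ) :=
  Algebra.adjoin ℂ ({adjMat G} ∪ Set.range (dualIdempotent G x))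

/-- A `T`-module: a subspace `W` of the standard module with `T W ⊆ W`. -/
def IsTModule (W : Submodule ℂ (V → ℂ)) : Prop :=
  ∀ B ∈ terwilligerAlgebra G x, ∀ w ∈ W, B.mulVec w ∈ W

/-- Irreducible `T`-modules. -/
def IsIrreducibleTModule (W : Submodule ℂ (V → ℂ)) : Prop :=
  IsTModule G x W ∧ W ≠ ⊥ ∧
    ∀ U : Submodule ℂ (V → ℂ), IsTModule G x U → U ≤ W → U = ⊥ ∨ U = W

/-- The subspace `E_i^* W`. -/
noncomputable def subconstituent (W : Submodule ℂ (V → ℂ)) (i : ℕ) : Submodule ℂ (V → ℂ) :=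
  W.map (dualIdempotent G x i).mulVecLin

/-- `W` has endpoint `r`, i.e. `r = min {i | E_i^* W ≠ 0}`. -/
def HasEndpoint (W : Submodule ℂ (V → ℂ)) (r : ℕ) : Prop :=
  IsLeast {i : ℕ | subconstituent G x W i ≠ ⊥} r

/-- `W` is thin: every `E_i^* W` has dimension at most one. -/
def IsThin (W : Submodule ℂ (V → ℂ)) : Prop :=
  ∀ i : ℕ, Module.finrank ℂ (subconstituent G x W i) ≤ 1

/-- `W` and `W'` are `T`-isomorphic: there is a linear isomorphism `σ : W → W'` with
`σ (B w) = B (σ w)` for all `B ∈ T`, `w ∈ W`. -/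
def TIsomorphic (W W' : Submodule ℂ (V → ℂ)) : Prop :=
  ∃ σ : W ≃ₗ[ℂ] W', ∀ B ∈ terwilligerAlgebra G x, ∀ w w₁ : W,
    (w₁ : V → ℂ) = B.mulVec (w : V → ℂ) → (σ w₁ : V → ℂ) = B.mulVec (σ w : V → ℂ)

end Algebra

section Construction

variable {X : Type u} {Y : Type v}

/-- The graph `H(Γ, S)`: the Cartesian product `Γ □ S` with a new vertex `w = none`, which is
joined to all vertices `(x, y)` with `y` a vertex of `S`. -/
def coneGraph (Γ : SimpleGraph X) (S : SimpleGraph Y) (x : X) :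
    SimpleGraph (Option (X × Y)) where
  Adj p q := match p, q with
    | none, none => False
    | none, some b => b.1 = x
    | some a, none => a.1 = x
    | some a, some b => (Γ □ S).Adj a b
  symm := ⟨fun p q h => by
    cases p <;> cases q
    · exact h
    · exact h
    · exact h
    · exact SimpleGraph.Adj.symm (G := Γ □ S) h⟩
  loopless := ⟨fun p h => by
    cases p
    · exact h
    · exact (Γ □ S).loopless.irrefl _ h⟩

end Construction

end TerwilligerGraph

/-! Pseudo-distance-regularity yields weights `ν` whose sum over the neighbours of `y` on a given
level is a multiple of `ν y` depending only on the two levels (`IsLevelWeight`). Everything said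
about `Γ` follows from this. The span of the restrictions of `ν` to the levels is an irreducible
thin `T(x)`-module, and `r^i(x, z)` is proportional to `ν z` on level `i`. One further step only
multiplies by a level constant, which gives part (2).

For part (1), take vectors `f ⊗ c` with `c` of zero sum over `Y`. The new vertex receives `f x * ∑ c
= 0`, so `T(w)` acts on `f` alone, with levels shifted by one and independently of `c`. A module of
endpoint `1` contains some `δ_x ⊗ c` of this kind. By irreducibility it is the level module tensored
with `c` (`IsLevelWeight.exists_eq_map_coneTensor`), and different `c` give isomorphic modules.

For part (3), a walk of shape `r^m` or `r^m t` between copies cannot visit `w`, since entering `w`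
lowers the distance. Its count is therefore that of `Γ` within one copy and zero between copies
(`StaysInCopy`). The distances to `v` tell whether `z` lies in the copy of `v`. -/

namespace TerwilligerGraph

universe u v

/-! ### Counting walks by shape -/

section Walks

variable {V : Type u} (G : SimpleGraph V) (x : V)

lemma length_walkShape {y z : V} (p : G.Walk y z) : (walkShape G x p).length = p.length := by
  induction p with
  | nil => rfl
  | cons h p ih => simp [walkShape, ih]

/-- The shape fixes the length. Finiteness is what makes `Nat.card` additive in the recursions
below. -/
lemma finite_walkShape [Finite V] (s : List Step) (y z : V) :
    Finite {p : G.Walk y z // walkShape G x p = s} := by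
  classical
  have := Fintype.ofFinite V
  have hfin : {p : G.Walk y z | p.length = s.length}.Finite := Set.toFinite _
  have hsub : {p : G.Walk y z | walkShape G x p = s} ⊆ {p | p.length = s.length} := by
    rintro p rfl
    exact (length_walkShape G x p).symm
  exact (hfin.subset hsub).to_subtype

lemma numWalks_nil [DecidableEq V] (y z : V) :
    numWalks G x [] y z = if y = z then 1 else 0 := by
  unfold numWalks
  split_ifs with h
  · subst h
    rw [Nat.card_eq_one_iff_exists]
    refine ⟨⟨.nil, rfl⟩, ?_⟩
    rintro ⟨p, hp⟩
    cases p with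
    | nil => rfl
    | cons h p => simp [walkShape] at hp
  · rw [Nat.card_eq_zero]
    left
    constructor
    rintro ⟨p, hp⟩
    cases p with
    | nil => exact h rfl
    | cons h p => simp [walkShape] at hp

open Classical in
lemma numWalks_cons [Fintype V] (t : Step) (s : List Step) (y z : V) :
    numWalks G x (t :: s) y z =
      ∑ q, if G.Adj y q ∧ stepSymbol (G.dist x y) (G.dist x q) = t
        then numWalks G x s q z else 0 := by
  have := fun q => finite_walkShape G x s q z
  unfold numWalks
  let f : (Σ q : {q : V // G.Adj y q ∧ stepSymbol (G.dist x y) (G.dist x q) = t},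
      {p : G.Walk q.1 z // walkShape G x p = s}) → {p : G.Walk y z // walkShape G x p = t :: s} :=
    fun a => ⟨.cons a.1.2.1 a.2.1, by simp [walkShape, a.1.2.2, a.2.2]⟩
  have hf : f.Bijective := by
    constructor
    · rintro ⟨⟨q, hq⟩, p, hp⟩ ⟨⟨q', hq'⟩, p', hp'⟩ h
      obtain ⟨rfl, h⟩ := SimpleGraph.Walk.cons.inj (congrArg Subtype.val h)
      obtain rfl := eq_of_heq h
      rfl
    · rintro ⟨p, hp⟩
      cases p with
      | nil => simp [walkShape] at hp
      | cons h p =>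
        rw [walkShape, List.cons.injEq] at hp
        exact ⟨⟨⟨_, h, hp.1⟩, p, hp.2⟩, rfl⟩
  rw [← Nat.card_congr (Equiv.ofBijective f hf), Nat.card_sigma, ← Finset.sum_filter]
  exact (Finset.sum_subtype _ (by simp)
    fun q => Nat.card {p : G.Walk q z // walkShape G x p = s}).symm

open Classical in
lemma numWalks_concat [Fintype V] (t : Step) (s : List Step) (y z : V) :
    numWalks G x (s ++ [t]) y z =
      ∑ q, if G.Adj q z ∧ stepSymbol (G.dist x q) (G.dist x z) = t
        then numWalks G x s y q else 0 := by
  induction s generalizing y with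
  | nil =>
    rw [List.nil_append, numWalks_cons]
    simp only [numWalks_nil]
    rw [Finset.sum_eq_single z, Finset.sum_eq_single y] <;> aesop
  | cons t' s ih =>
    rw [List.cons_append, numWalks_cons]
    simp only [ih, numWalks_cons, ← Finset.sum_filter]
    exact Finset.sum_comm

lemma stepSymbol_eq_r {m n : ℕ} : stepSymbol m n = .r ↔ n = m + 1 := by
  unfold stepSymbol; split_ifs <;> simp_all

lemma stepSymbol_eq_f {m n : ℕ} : stepSymbol m n = .f ↔ n = m := by
  unfold stepSymbol; split_ifs <;> simp_all

lemma stepSymbol_eq_l {m n : ℕ} : stepSymbol m n = .l ↔ n ≠ m ∧ n ≠ m + 1 := by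
  unfold stepSymbol; split_ifs <;> simp_all

lemma stepSymbol_succ (m n : ℕ) : stepSymbol (m + 1) (n + 1) = stepSymbol m n := by
  simp [stepSymbol]

variable {G}

lemma dist_le_succ_of_adj (hG : G.Connected) {y z : V} (h : G.Adj y z) :
    G.dist x z ≤ G.dist x y + 1 := by
  have := hG.dist_triangle (u := x) (v := y) (w := z)
  rwa [SimpleGraph.dist_eq_one_iff_adj.2 h] at this

end Walks

/-! ### Level weights and the walk scalars of `Γ` -/

section LevelWeight

variable {V : Type u} [Fintype V] (G : SimpleGraph V) (x : V)

open Classical in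
/-- Nowhere zero complex vertex weights `ν` for which the total weight of the neighbours at
distance `j` from `x` of a vertex `y` is `k j (∂(x, y)) * ν y`, and this coefficient does not vanish
if such neighbours exist. -/
structure IsLevelWeight (ν : V → ℂ) (k : ℕ → ℕ → ℂ) : Prop where
  ne_zero : ∀ y, ν y ≠ 0
  sum_eq : ∀ j y, (∑ z, if G.Adj y z ∧ G.dist x z = j then ν z else 0) = k j (G.dist x y) * ν y
  coeff_ne_zero : ∀ y z, G.Adj y z → k (G.dist x z) (G.dist x y) ≠ 0

variable {G x}

lemma IsPseudoDistanceRegularAround.exists_isLevelWeight (hG : G.Connected)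
    (h : IsPseudoDistanceRegularAround G x) : ∃ ν k, IsLevelWeight G x ν k := by
  classical
  obtain ⟨ν, -, hν, -, c, a, b, hcab⟩ := h
  have key : ∃ k : ℕ → ℕ → ℝ, ∀ j y,
      (∑ z, if G.Adj y z ∧ G.dist x z = j then ν z else 0) = k j (G.dist x y) * ν y := by
    -- The value `0` covers levels differing by more than one, between which there are no edges.
    refine ⟨fun j i => if j + 1 = i then c i else if j = i then a i
      else if j = i + 1 then b i else 0, fun j y => ?_⟩
    obtain ⟨h1, h2, h3⟩ := hcab y
    have e (P : V → Prop) [DecidablePred P] :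
        (∑ z with P z, ν z / ν y) * ν y = ∑ z, if P z then ν z else 0 := by
      rw [Finset.sum_mul, Finset.sum_filter]
      refine Finset.sum_congr rfl fun z _ => ?_
      split_ifs
      · exact div_mul_cancel₀ _ (hν y).ne'
      · rfl
    dsimp only
    split_ifs with i1 i2 i3
    · rw [← h1, e]
      refine Finset.sum_congr rfl fun z _ => ?_
      congr 1
      rw [← i1, add_left_inj]
    · rw [← h2, e, i2]
    · rw [← h3, e, i3]
    · rw [zero_mul]
      refine Finset.sum_eq_zero fun z _ => if_neg ?_
      rintro ⟨hz, rfl⟩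
      have := dist_le_succ_of_adj x hG hz
      have := dist_le_succ_of_adj x hG hz.symm
      omega
  obtain ⟨k, hk⟩ := key
  refine ⟨fun y => ν y, fun j i => k j i, fun y => by exact_mod_cast (hν y).ne', fun j y => ?_,
    fun y z hyz h0 => ?_⟩
  · rw [← Complex.ofReal_mul, ← hk, Complex.ofReal_sum]
    refine Finset.sum_congr rfl fun z _ => ?_
    split_ifs <;> simp
  · have h0 : k (G.dist x z) (G.dist x y) = 0 := by exact_mod_cast h0
    have := hk (G.dist x z) y
    rw [h0, zero_mul, Finset.sum_eq_zero_iff_of_nonneg] at this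
    · have := this z (Finset.mem_univ _)
      rw [if_pos ⟨hyz, rfl⟩] at this
      exact (hν z).ne' this
    · intro q _
      split_ifs
      exacts [(hν q).le, le_rfl]

variable {ν : V → ℂ} {k : ℕ → ℕ → ℂ}

/-- Split by the penultimate vertex `q`: a last step of type `t` into `z` must start on level `j`,
so the count becomes a weighted neighbour sum at `z`. -/
lemma IsLevelWeight.numWalks_concat_eq (h : IsLevelWeight G x ν k) {t : Step} {s : List Step}
    {g : ℂ} {j : ℕ} {y z : V} (hs : ∀ q, G.dist x q = j → (numWalks G x s y q : ℂ) = g * ν q)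
    (ht : ∀ q, G.Adj q z → (stepSymbol (G.dist x q) (G.dist x z) = t ↔ G.dist x q = j)) :
    (numWalks G x (s ++ [t]) y z : ℂ) = g * (k j (G.dist x z) * ν z) := by
  classical
  rw [numWalks_concat, ← h.sum_eq, Finset.mul_sum, Nat.cast_sum]
  refine Finset.sum_congr rfl fun q _ => ?_
  by_cases hq : G.Adj q z
  · by_cases hj : G.dist x q = j
    · rw [if_pos ⟨hq, (ht q hq).2 hj⟩, if_pos ⟨hq.symm, hj⟩, hs q hj]
    · rw [if_neg (fun h' => hj ((ht q hq).1 h'.2)), if_neg (fun h' => hj h'.2)]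
      simp
  · rw [if_neg (fun h' => hq h'.1), if_neg (fun h' => hq h'.1.symm)]
    simp

lemma IsLevelWeight.exists_rPow_eq (hG : G.Connected) (h : IsLevelWeight G x ν k) :
    ∃ γ : ℕ → ℂ, (∀ i, γ (i + 1) = γ i * k i (i + 1)) ∧
      ∀ i z, G.dist x z = i → (rPow G x i x z : ℂ) = γ i * ν z := by
  classical
  -- The start `(ν x)⁻¹` normalises the single walk of length zero at `x`.
  refine ⟨fun i => Nat.rec (ν x)⁻¹ (fun j g => g * k j (j + 1)) i, fun i => rfl, fun i => ?_⟩
  induction i with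
  | zero =>
    intro z hz
    obtain rfl := (hG.dist_eq_zero_iff).1 hz
    simp [rPow, numWalks_nil, h.ne_zero]
  | succ i ih =>
    intro z hz
    rw [rPow, List.replicate_succ', h.numWalks_concat_eq (j := i) ih]
    · rw [hz]
      ring
    · intro q hq
      rw [stepSymbol_eq_r, hz, add_left_inj, eq_comm]

lemma IsLevelWeight.exists_trivialWalkScalars (hG : G.Connected) (h : IsLevelWeight G x ν k) :
    ∃ α β, TrivialWalkScalars G x α β := by
  obtain ⟨γ, hγ, hr⟩ := h.exists_rPow_eq hG
  -- Going up from level `i` and back down multiplies the count by both level constants; a flat step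
  -- multiplies it by one.
  refine ⟨fun i => k i (i + 1) * k (i + 1) i, fun i => k i i, fun i _ z hz => ⟨?_, ?_⟩⟩
  · rw [rPowL, h.numWalks_concat_eq (hr (i + 1)), hr i z hz, hz, hγ]
    · ring
    · intro q hq
      rw [stepSymbol_eq_l, hz]
      have := dist_le_succ_of_adj x hG hq
      have := dist_le_succ_of_adj x hG hq.symm
      omega
  · rw [rPowF, h.numWalks_concat_eq (hr i), hr i z hz, hz]
    · ring
    · intro q hq
      rw [stepSymbol_eq_f, hz, eq_comm]

end LevelWeight

/-! ### Distances and walks in the cone graph -/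

section Cone

variable {X : Type u} {Y : Type v} {Γ : SimpleGraph X} {x : X}

/-- Lower bounds on distances come from functions that grow by at most one along each edge. -/
lemma le_dist_of_adj_le_succ {V : Type u} {G : SimpleGraph V} (hG : G.Connected) {f : V → ℕ}
    (hf : ∀ a b, G.Adj a b → f b ≤ f a + 1) {a b : V} (ha : f a = 0) : f b ≤ G.dist a b := by
  have key : ∀ {a b : V} (p : G.Walk a b), f b ≤ f a + p.length := by
    intro a b p
    induction p with
    | nil => simp
    | cons h p ih =>
      have := hf _ _ h
      rw [SimpleGraph.Walk.length_cons]
      omega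
  obtain ⟨p, hp⟩ := hG.exists_walk_length_eq_dist a b
  have := key p
  omega

@[simp]
lemma coneGraph_bot_adj_some_some {a b : X} {y z : Y} :
    (coneGraph Γ (⊥ : SimpleGraph Y) x).Adj (some (a, y)) (some (b, z)) ↔ Γ.Adj a b ∧ y = z := by
  change (Γ □ ⊥).Adj (a, y) (b, z) ↔ _
  simp [SimpleGraph.boxProd_adj]

@[simp]
lemma coneGraph_adj_none_some {S : SimpleGraph Y} {b : X × Y} :
    (coneGraph Γ S x).Adj none (some b) ↔ b.1 = x := Iff.rfl

/-- The embedding of `Γ` as the copy indexed by `y` in the cone graph. -/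
def coneCopy (Γ : SimpleGraph X) (x : X) (y : Y) :
    Γ →g coneGraph Γ (⊥ : SimpleGraph Y) x where
  toFun a := some (a, y)
  map_rel' h := by simpa using h

lemma exists_walk_same_copy (hΓ : Γ.Connected) (a : X) (y : Y) :
    ∃ p : (coneGraph Γ (⊥ : SimpleGraph Y) x).Walk (some (x, y)) (some (a, y)),
      p.length = Γ.dist x a := by
  obtain ⟨p, hp⟩ := hΓ.exists_walk_length_eq_dist x a
  exact ⟨p.map (coneCopy Γ x y), (SimpleGraph.Walk.length_map _ p).trans hp⟩

lemma exists_walk_none_some (hΓ : Γ.Connected) (a : X) (y : Y) :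
    ∃ p : (coneGraph Γ (⊥ : SimpleGraph Y) x).Walk none (some (a, y)),
      p.length = Γ.dist x a + 1 := by
  obtain ⟨p, hp⟩ := exists_walk_same_copy (x := x) hΓ a y
  exact ⟨.cons (coneGraph_adj_none_some.2 rfl) p, by rw [SimpleGraph.Walk.length_cons, hp]⟩

lemma coneGraph_connected (hΓ : Γ.Connected) :
    (coneGraph Γ (⊥ : SimpleGraph Y) x).Connected := by
  have h : ∀ q, (coneGraph Γ (⊥ : SimpleGraph Y) x).Reachable none q := by
    rintro (_ | ⟨a, y⟩)
    · rfl
    · exact (exists_walk_none_some hΓ a y).choose.reachable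
  exact ⟨fun p q => (h p).symm.trans (h q)⟩

lemma coneGraph_dist_none_some (hΓ : Γ.Connected) (a : X) (y : Y) :
    (coneGraph Γ (⊥ : SimpleGraph Y) x).dist none (some (a, y)) = Γ.dist x a + 1 := by
  apply le_antisymm
  · obtain ⟨p, hp⟩ := exists_walk_none_some (x := x) hΓ a y
    exact hp ▸ SimpleGraph.dist_le p
  · refine le_dist_of_adj_le_succ (coneGraph_connected hΓ) (a := none) (b := some (a, y))
      (f := fun q => q.elim 0 fun b => Γ.dist x b.1 + 1) ?_ rfl
    rintro (_ | ⟨a, y⟩) (_ | ⟨b, z⟩) h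
    · simp
    · obtain rfl : b = x := h
      simp
    · simp
    · have := dist_le_succ_of_adj x hΓ (coneGraph_bot_adj_some_some.1 h).1
      simpa using this

lemma coneGraph_dist_same_copy_le (hΓ : Γ.Connected) (a : X) (y : Y) :
    (coneGraph Γ (⊥ : SimpleGraph Y) x).dist (some (x, y)) (some (a, y)) ≤ Γ.dist x a := by
  obtain ⟨p, hp⟩ := exists_walk_same_copy (x := x) hΓ a y
  exact hp ▸ SimpleGraph.dist_le p

lemma le_coneGraph_dist_of_ne (hΓ : Γ.Connected) (a : X) {y z : Y} (hyz : y ≠ z) :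
    Γ.dist x a + 2 ≤
      (coneGraph Γ (⊥ : SimpleGraph Y) x).dist (some (x, y)) (some (a, z)) := by
  classical
  have := le_dist_of_adj_le_succ (coneGraph_connected (Y := Y) (x := x) hΓ)
    -- Leaving copy `y` is possible only through `w`, which gets value `1`; every other copy is then
    -- entered at its vertex over `x`, with value `2`.
    (f := fun q => q.elim 1 fun b => if b.2 = y then 0 else Γ.dist x b.1 + 2)
    (a := some (x, y)) (b := some (a, z)) ?_ (by simp)
  · simpa [hyz.symm] using this
  · rintro (_ | ⟨a, y'⟩) (_ | ⟨b, z'⟩) h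
    · simp
    · obtain rfl : b = x := h
      simp only [Option.elim]
      split_ifs <;> simp
    · simp
    · obtain ⟨hab, rfl⟩ := coneGraph_bot_adj_some_some.1 h
      have := dist_le_succ_of_adj x hΓ hab
      simp only [Option.elim]
      split_ifs <;> omega

/-- Walks of shape `s` between vertices of the copies of `Γ` in the cone graph are walks of `Γ`
inside a single copy. -/
def StaysInCopy (Y : Type v) [DecidableEq Y] (Γ : SimpleGraph X) (x : X) (s : List Step) : Prop :=
  ∀ (a b : X) (y z : Y), numWalks (coneGraph Γ (⊥ : SimpleGraph Y) x) none s
    (some (a, y)) (some (b, z)) = if y = z then numWalks Γ x s a b else 0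

variable [DecidableEq Y]

lemma staysInCopy_nil : StaysInCopy Y Γ x [] := by
  classical
  intro a b y z
  simp only [numWalks_nil, Option.some.injEq, Prod.mk.injEq]
  split_ifs <;> simp_all

variable [Fintype X] [Fintype Y]

/-- The first step cannot lead to `w`: a raising step never does, and if it is the last step it must
end in a copy. -/
lemma StaysInCopy.cons (hΓ : Γ.Connected) {t : Step} {s : List Step} (hs : StaysInCopy Y Γ x s)
    (ht : t = .r ∨ s = []) : StaysInCopy Y Γ x (t :: s) := by
  classical
  intro a b y z
  have h0 : (if (coneGraph Γ (⊥ : SimpleGraph Y) x).Adj (some (a, y)) none ∧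
      stepSymbol ((coneGraph Γ (⊥ : SimpleGraph Y) x).dist none (some (a, y)))
        ((coneGraph Γ (⊥ : SimpleGraph Y) x).dist none none) = t then
      numWalks (coneGraph Γ (⊥ : SimpleGraph Y) x) none s none (some (b, z)) else 0) = 0 := by
    rcases ht with rfl | rfl
    · simp [stepSymbol_eq_r]
    · simp [numWalks_nil]
  rw [numWalks_cons, numWalks_cons, Fintype.sum_option, h0, zero_add, Fintype.sum_prod_type]
  have hs' := fun c y' => hs c b y' z
  simp only [hs', coneGraph_dist_none_some hΓ, stepSymbol_succ, coneGraph_bot_adj_some_some]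
  have : ∀ c : X, (∑ y' : Y, if (Γ.Adj a c ∧ y = y') ∧ stepSymbol (Γ.dist x a) (Γ.dist x c) = t
      then if y' = z then numWalks Γ x s c b else 0 else 0) =
      if y = z then if Γ.Adj a c ∧ stepSymbol (Γ.dist x a) (Γ.dist x c) = t
        then numWalks Γ x s c b else 0 else 0 := by
    intro c
    rw [Finset.sum_eq_single y]
    · split_ifs <;> simp_all
    · rintro y' - hy'
      exact if_neg fun h => hy' h.1.2.symm
    · simp
  simp only [this]
  split_ifs <;> simp

lemma StaysInCopy.replicate_append (hΓ : Γ.Connected) {s : List Step} (hs : StaysInCopy Y Γ x s)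
    (m : ℕ) : StaysInCopy Y Γ x (List.replicate m .r ++ s) := by
  induction m with
  | zero => exact hs
  | succ m ih => exact ih.cons hΓ (.inl rfl)

lemma TrivialWalkScalars.walkConditions_coneGraph (hΓ : Γ.Connected) {α β : ℕ → ℂ}
    (h : TrivialWalkScalars Γ x α β) :
    WalkConditions (coneGraph Γ (⊥ : SimpleGraph Y) x) none
      (fun i => α (i - 1)) (fun _ => 0) (fun i => β (i - 1)) (fun _ => 0) := by
  have hsingle (t : Step) : StaysInCopy Y Γ x [t] := staysInCopy_nil.cons hΓ (.inr rfl)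
  have hr (m : ℕ) : StaysInCopy Y Γ x (List.replicate m .r) := by
    simpa using staysInCopy_nil.replicate_append (Y := Y) hΓ m
  have hrt (m : ℕ) (t : Step) := (hsingle t).replicate_append hΓ m
  intro i hi _
  refine ⟨?_, fun _ => rfl⟩
  rintro (_ | ⟨a, y⟩) hv
  · exact absurd hv (SimpleGraph.irrefl _)
  obtain rfl : a = x := hv
  constructor
  · rintro (_ | ⟨b, z⟩) hz
    · simp [distCell] at hz
      omega
    -- In the copy of `v` the distance to `v` would be at most `i - 1`. So `z` is in another copy,
    -- and all counts on the left vanish.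
    · have hyz : y ≠ z := by
        rintro rfl
        have := coneGraph_dist_same_copy_le (x := a) hΓ b y
        simp only [distCell, coneGraph_dist_none_some hΓ, Set.mem_union, Set.mem_ofPred_eq] at hz
        omega
      simp [rPowL, rPowF, hrt _ _ _ _ _ _, hyz]
  · rintro (_ | ⟨b, z⟩) ⟨hz, hz'⟩
    · simp at hz
      omega
    · rw [coneGraph_dist_none_some hΓ] at hz
      obtain rfl : y = z := by
        by_contra hyz
        have := le_coneGraph_dist_of_ne (x := a) hΓ b hyz
        omega
      obtain ⟨i, rfl⟩ : ∃ j, i = j + 1 := ⟨i - 1, by omega⟩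
      have hb : Γ.dist a b = i := by omega
      -- The bound needed to apply `h` in `Γ` is witnessed by `b` itself.
      have hecc : (i : ℕ∞) ≤ Γ.eccent a := by
        rw [← hb, (hΓ.preconnected a b).coe_dist_eq_edist]
        exact SimpleGraph.edist_le_eccent
      have := h i hecc b hb
      simpa [rPowL, rPowF, rPow, hrt _ _ _ _ _ _, hr _ _ _ _ _] using this

end Cone

/-! ### The irreducible level module -/

section Module

variable {V : Type u} {G : SimpleGraph V} {x : V}

/-- The vectors whose entries are `ν` times a function of the distance from `x`. -/
def levelModule (G : SimpleGraph V) (x : V) (ν : V → ℂ) : Submodule ℂ (V → ℂ) where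
  carrier := {f | ∃ t : ℕ → ℂ, ∀ y, f y = t (G.dist x y) * ν y}
  add_mem' := by
    rintro f g ⟨t, ht⟩ ⟨t', ht'⟩
    exact ⟨t + t', fun y => by simp [ht, ht', add_mul]⟩
  zero_mem' := ⟨0, by simp⟩
  smul_mem' := by
    rintro c f ⟨t, ht⟩
    exact ⟨c • t, fun y => by simp [ht, mul_assoc]⟩

/-- The restriction of `ν` to the vertices at distance `i` from `x`. -/
noncomputable def levelVec (G : SimpleGraph V) (x : V) (ν : V → ℂ) (i : ℕ) : V → ℂ :=
  fun y => if G.dist x y = i then ν y else 0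

variable {ν : V → ℂ} {k : ℕ → ℕ → ℂ}

lemma levelVec_mem (i : ℕ) : levelVec G x ν i ∈ levelModule G x ν :=
  ⟨fun j => if j = i then 1 else 0, fun y => by simp [levelVec]⟩

variable [Fintype V]

lemma levelModule_le {U : Submodule ℂ (V → ℂ)} (h : ∀ i, levelVec G x ν i ∈ U) :
    levelModule G x ν ≤ U := by
  rintro f ⟨t, ht⟩
  have : f = ∑ i ∈ Finset.univ.image (G.dist x), t i • levelVec G x ν i := by
    ext y
    simp [levelVec, ht]
  rw [this]
  exact U.sum_mem fun i _ => U.smul_mem _ (h i)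

lemma adjMat_mulVec_apply [DecidableRel G.Adj] (f : V → ℂ) (y : V) :
    (adjMat G).mulVec f y = ∑ z, if G.Adj y z then f z else 0 := by
  simp only [adjMat, Matrix.mulVec, dotProduct, SimpleGraph.adjMatrix_apply, ite_mul, one_mul,
    zero_mul]

lemma IsLevelWeight.adjMat_mulVec_levelVec (h : IsLevelWeight G x ν k) (i : ℕ) (y : V) :
    (adjMat G).mulVec (levelVec G x ν i) y = k i (G.dist x y) * ν y := by
  classical
  rw [← h.sum_eq, adjMat_mulVec_apply]
  refine Finset.sum_congr rfl fun z _ => ?_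
  rw [levelVec, ← ite_and]

variable [DecidableEq V]

lemma dualIdempotent_mulVec_apply (i : ℕ) (f : V → ℂ) (y : V) :
    (dualIdempotent G x i).mulVec f y = if G.dist x y = i then f y else 0 := by
  simp [dualIdempotent, Matrix.mulVec_diagonal]

lemma adjMat_mem : adjMat G ∈ terwilligerAlgebra G x :=
  Algebra.subset_adjoin (.inl rfl)

lemma dualIdempotent_mem (i : ℕ) : dualIdempotent G x i ∈ terwilligerAlgebra G x :=
  Algebra.subset_adjoin (.inr ⟨i, rfl⟩)

lemma isTModule_iff {W : Submodule ℂ (V → ℂ)} :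
    IsTModule G x W ↔ (∀ f ∈ W, (adjMat G).mulVec f ∈ W) ∧
      ∀ i, ∀ f ∈ W, (dualIdempotent G x i).mulVec f ∈ W := by
  refine ⟨fun h => ⟨h _ adjMat_mem, fun i => h _ (dualIdempotent_mem i)⟩, fun h B hB => ?_⟩
  induction hB using Algebra.adjoin_induction with
  | mem B hB =>
    rcases hB with rfl | ⟨i, rfl⟩
    exacts [h.1, h.2 i]
  | algebraMap r =>
    intro f hf
    rw [Algebra.algebraMap_eq_smul_one, Matrix.smul_mulVec, Matrix.one_mulVec]
    exact W.smul_mem r hf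
  | add B C _ _ hB hC =>
    intro f hf
    rw [Matrix.add_mulVec]
    exact W.add_mem (hB f hf) (hC f hf)
  | mul B C _ _ hB hC =>
    intro f hf
    rw [← Matrix.mulVec_mulVec]
    exact hB _ (hC f hf)

lemma IsTModule.inf {U W : Submodule ℂ (V → ℂ)} (hU : IsTModule G x U) (hW : IsTModule G x W) :
    IsTModule G x (U ⊓ W) :=
  fun B hB f hf => ⟨hU B hB f hf.1, hW B hB f hf.2⟩

lemma dualIdempotent_mulVec_levelModule {f : V → ℂ} {t : ℕ → ℂ}
    (ht : ∀ y, f y = t (G.dist x y) * ν y) (i : ℕ) :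
    (dualIdempotent G x i).mulVec f = t i • levelVec G x ν i := by
  ext y
  rw [dualIdempotent_mulVec_apply]
  by_cases h : G.dist x y = i <;> simp [levelVec, h, ht]

lemma IsLevelWeight.isTModule_levelModule (h : IsLevelWeight G x ν k) :
    IsTModule G x (levelModule G x ν) := by
  refine isTModule_iff.2 ⟨?_, ?_⟩
  · exact levelModule_le (U := (levelModule G x ν).comap (adjMat G).mulVecLin)
      fun i => ⟨k i, h.adjMat_mulVec_levelVec i⟩
  · rintro i f ⟨t, ht⟩
    rw [dualIdempotent_mulVec_levelModule ht]
    exact Submodule.smul_mem _ _ (levelVec_mem i)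

/-- Applying the adjacency matrix and then projecting to the new level gives a nonzero multiple of
its level vector. -/
lemma IsLevelWeight.levelVec_mem_of_adj (h : IsLevelWeight G x ν k) {U : Submodule ℂ (V → ℂ)}
    (hU : IsTModule G x U) {y z : V} (hyz : G.Adj y z)
    (hy : levelVec G x ν (G.dist x y) ∈ U) : levelVec G x ν (G.dist x z) ∈ U := by
  have := hU _ (dualIdempotent_mem (G.dist x z)) _ (hU _ adjMat_mem _ hy)
  rw [dualIdempotent_mulVec_levelModule (h.adjMat_mulVec_levelVec _)] at this
  exact (U.smul_mem_iff (h.coeff_ne_zero z y hyz.symm)).1 this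

lemma IsLevelWeight.levelVec_mem_of_connected (hG : G.Connected) (h : IsLevelWeight G x ν k)
    {U : Submodule ℂ (V → ℂ)} (hU : IsTModule G x U) {y : V}
    (hy : levelVec G x ν (G.dist x y) ∈ U) (z : V) : levelVec G x ν (G.dist x z) ∈ U := by
  obtain ⟨p⟩ := hG.preconnected y z
  induction p with
  | nil => exact hy
  | cons hadj p ih => exact ih (h.levelVec_mem_of_adj hU hadj hy)

/-- A nonzero submodule contains, by projection, one nonzero level vector; connectedness then
carries this to all levels. -/
lemma IsLevelWeight.isIrreducibleTModule_levelModule (hG : G.Connected)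
    (h : IsLevelWeight G x ν k) : IsIrreducibleTModule G x (levelModule G x ν) := by
  refine ⟨h.isTModule_levelModule, ?_, fun U hU hle => or_iff_not_imp_left.2 fun hne => ?_⟩
  · refine (Submodule.ne_bot_iff _).2 ⟨ν, ⟨1, by simp⟩, fun h0 => h.ne_zero x (congrFun h0 x)⟩
  · refine le_antisymm hle (levelModule_le fun i => ?_)
    obtain ⟨f, hf, hf0⟩ := (Submodule.ne_bot_iff _).1 hne
    obtain ⟨t, ht⟩ := hle hf
    obtain ⟨y, hy⟩ := Function.ne_iff.1 hf0
    have hmem := hU _ (dualIdempotent_mem (G.dist x y)) f hf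
    rw [dualIdempotent_mulVec_levelModule ht] at hmem
    have ht0 : t (G.dist x y) ≠ 0 := by
      intro h0
      rw [ht, h0, zero_mul] at hy
      exact hy rfl
    by_cases hi : ∃ z, G.dist x z = i
    · obtain ⟨z, rfl⟩ := hi
      exact h.levelVec_mem_of_connected hG hU ((U.smul_mem_iff ht0).1 hmem) z
    -- An empty level has zero level vector.
    · convert U.zero_mem
      ext z
      exact if_neg fun hz => hi ⟨z, hz⟩

end Module

/-! ### Modules of endpoint one in the cone graph -/

section ConeModule

variable {X : Type u} {Y : Type v}

/-- The map `f ↦ f ⊗ c` into the standard module of the cone graph. -/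
def coneTensor (X : Type u) (c : Y → ℂ) : (X → ℂ) →ₗ[ℂ] (Option (X × Y) → ℂ) where
  toFun f q := q.elim 0 fun b => f b.1 * c b.2
  map_add' f g := by ext (_ | q) <;> simp [add_mul]
  map_smul' a f := by ext (_ | q) <;> simp [mul_assoc]

@[simp]
lemma coneTensor_none (c : Y → ℂ) (f : X → ℂ) : coneTensor X c f none = 0 := rfl

@[simp]
lemma coneTensor_some (c : Y → ℂ) (f : X → ℂ) (a : X) (y : Y) :
    coneTensor X c f (some (a, y)) = f a * c y := rfl

lemma coneTensor_injective {c : Y → ℂ} (hc : c ≠ 0) : Function.Injective (coneTensor X c) := by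
  obtain ⟨y, hy⟩ := Function.ne_iff.1 hc
  intro f g h
  ext a
  exact mul_right_cancel₀ hy (congrFun h (some (a, y)))

variable [Fintype X] [DecidableEq X] [Fintype Y] [DecidableEq Y] {Γ : SimpleGraph X} {x : X}

/-- The entry at `w` is `f x * ∑ c = 0`; conversely `w` contributes nothing, and distinct copies are
not adjacent. -/
lemma adjMat_mulVec_coneTensor {c : Y → ℂ} (hc : ∑ y, c y = 0) (f : X → ℂ) :
    (adjMat (coneGraph Γ (⊥ : SimpleGraph Y) x)).mulVec (coneTensor X c f) =
      coneTensor X c ((adjMat Γ).mulVec f) := by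
  classical
  ext (_ | ⟨a, y⟩)
  · rw [adjMat_mulVec_apply, Fintype.sum_option, Fintype.sum_prod_type]
    simp only [coneTensor_none, coneTensor_some, coneGraph_adj_none_some, ite_self, zero_add]
    rw [Finset.sum_eq_single x]
    · simp [← Finset.mul_sum, hc]
    · intro b _ hb
      simp [hb]
    · simp
  · rw [adjMat_mulVec_apply, Fintype.sum_option, Fintype.sum_prod_type, coneTensor_some,
      adjMat_mulVec_apply, Finset.sum_mul]
    simp only [coneTensor_none, coneTensor_some, coneGraph_bot_adj_some_some, ite_self, zero_add]
    refine Finset.sum_congr rfl fun b _ => ?_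
    simp [ite_and]

lemma dualIdempotent_zero_mulVec_coneTensor (hΓ : Γ.Connected) (c : Y → ℂ) (f : X → ℂ) :
    (dualIdempotent (coneGraph Γ (⊥ : SimpleGraph Y) x) none 0).mulVec (coneTensor X c f) = 0 := by
  ext (_ | ⟨a, y⟩) <;> simp [dualIdempotent_mulVec_apply, coneGraph_dist_none_some hΓ]

lemma dualIdempotent_succ_mulVec_coneTensor (hΓ : Γ.Connected) (c : Y → ℂ) (f : X → ℂ) (i : ℕ) :
    (dualIdempotent (coneGraph Γ (⊥ : SimpleGraph Y) x) none (i + 1)).mulVec (coneTensor X c f) =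
      coneTensor X c ((dualIdempotent Γ x i).mulVec f) := by
  ext (_ | ⟨a, y⟩) <;> simp [dualIdempotent_mulVec_apply, coneGraph_dist_none_some hΓ]

lemma IsTModule.comap_coneTensor (hΓ : Γ.Connected) {c : Y → ℂ} (hc : ∑ y, c y = 0)
    {U : Submodule ℂ (Option (X × Y) → ℂ)}
    (hU : IsTModule (coneGraph Γ (⊥ : SimpleGraph Y) x) none U) :
    IsTModule Γ x (U.comap (coneTensor X c)) := by
  refine isTModule_iff.2 ⟨fun f hf => ?_, fun i f hf => ?_⟩
  · rw [Submodule.mem_comap, ← adjMat_mulVec_coneTensor (x := x) hc]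
    exact hU _ adjMat_mem _ hf
  · rw [Submodule.mem_comap, ← dualIdempotent_succ_mulVec_coneTensor hΓ]
    exact hU _ (dualIdempotent_mem _) _ hf

lemma IsTModule.map_coneTensor (hΓ : Γ.Connected) {c : Y → ℂ} (hc : ∑ y, c y = 0)
    {P : Submodule ℂ (X → ℂ)} (hP : IsTModule Γ x P) :
    IsTModule (coneGraph Γ (⊥ : SimpleGraph Y) x) none (P.map (coneTensor X c)) := by
  refine isTModule_iff.2 ⟨?_, ?_⟩
  · rintro _ ⟨f, hf, rfl⟩
    rw [adjMat_mulVec_coneTensor hc]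
    exact Submodule.mem_map_of_mem (hP _ adjMat_mem _ hf)
  · rintro (_ | i) _ ⟨f, hf, rfl⟩
    · rw [dualIdempotent_zero_mulVec_coneTensor hΓ]
      exact Submodule.zero_mem _
    · rw [dualIdempotent_succ_mulVec_coneTensor hΓ]
      exact Submodule.mem_map_of_mem (hP _ (dualIdempotent_mem i) _ hf)

/-- For fixed `c ≠ 0` the tensor map is injective and matches submodules of `P` with submodules of
its image, in both directions. -/
lemma IsIrreducibleTModule.map_coneTensor (hΓ : Γ.Connected) {c : Y → ℂ} (hc : ∑ y, c y = 0)
    (hc0 : c ≠ 0) {P : Submodule ℂ (X → ℂ)} (hP : IsIrreducibleTModule Γ x P) :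
    IsIrreducibleTModule (coneGraph Γ (⊥ : SimpleGraph Y) x) none (P.map (coneTensor X c)) := by
  have hinj := coneTensor_injective (X := X) hc0
  refine ⟨hP.1.map_coneTensor hΓ hc, ?_, fun U hU hle => ?_⟩
  · intro h
    exact hP.2.1 (Submodule.map_injective_of_injective hinj (h.trans (Submodule.map_bot _).symm))
  · have hU' : (U.comap (coneTensor X c)).map (coneTensor X c) = U :=
      Submodule.map_comap_eq_of_le (hle.trans LinearMap.map_le_range)
    have hle' : U.comap (coneTensor X c) ≤ P := by
      rw [← Submodule.comap_map_eq_of_injective hinj P]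
      exact Submodule.comap_mono hle
    rcases hP.2.2 _ (hU.comap_coneTensor hΓ hc) hle' with h | h
    · left
      rw [← hU', h, Submodule.map_bot]
    · right
      rw [← hU', h]

/-- An element of the Terwilliger algebra of the cone graph acts on all the spaces of vectors
`f ⊗ c` with `c` of zero sum through one and the same operator. -/
lemma exists_mulVec_coneTensor (hΓ : Γ.Connected)
    {B : Matrix (Option (X × Y)) (Option (X × Y)) ℂ}
    (hB : B ∈ terwilligerAlgebra (coneGraph Γ (⊥ : SimpleGraph Y) x) none) :
    ∃ L : Matrix X X ℂ, ∀ c : Y → ℂ, ∑ y, c y = 0 → ∀ f,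
      B.mulVec (coneTensor X c f) = coneTensor X c (L.mulVec f) := by
  induction hB using Algebra.adjoin_induction with
  | mem B hB =>
    rcases hB with rfl | ⟨_ | i, rfl⟩
    · exact ⟨adjMat Γ, fun c hc => adjMat_mulVec_coneTensor hc⟩
    · exact ⟨0, fun c _ f => by
        rw [dualIdempotent_zero_mulVec_coneTensor hΓ, Matrix.zero_mulVec, map_zero]⟩
    · exact ⟨dualIdempotent Γ x i, fun c _ f => dualIdempotent_succ_mulVec_coneTensor hΓ c f i⟩
  | algebraMap r =>
    refine ⟨r • 1, fun c _ f => ?_⟩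
    rw [Algebra.algebraMap_eq_smul_one, Matrix.smul_mulVec, Matrix.smul_mulVec, Matrix.one_mulVec,
      Matrix.one_mulVec, map_smul]
  | add B C _ _ hB hC =>
    obtain ⟨L, hL⟩ := hB
    obtain ⟨M, hM⟩ := hC
    exact ⟨L + M, fun c hc f => by
      rw [Matrix.add_mulVec, Matrix.add_mulVec, map_add, hL c hc, hM c hc]⟩
  | mul B C _ _ hB hC =>
    obtain ⟨L, hL⟩ := hB
    obtain ⟨M, hM⟩ := hC
    exact ⟨L * M, fun c hc f => by
      rw [← Matrix.mulVec_mulVec, ← Matrix.mulVec_mulVec, hM c hc, hL c hc]⟩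

/-- The isomorphism is `f ⊗ c ↦ f ⊗ c'`; it commutes with `B` because the operator `L` does not
depend on `c`. -/
lemma tIsomorphic_map_coneTensor (hΓ : Γ.Connected) {c c' : Y → ℂ} (hc : ∑ y, c y = 0)
    (hc0 : c ≠ 0) (hc' : ∑ y, c' y = 0) (hc0' : c' ≠ 0) (P : Submodule ℂ (X → ℂ)) :
    TIsomorphic (coneGraph Γ (⊥ : SimpleGraph Y) x) none
      (P.map (coneTensor X c)) (P.map (coneTensor X c')) := by
  let e := P.equivMapOfInjective _ (coneTensor_injective hc0)
  let e' := P.equivMapOfInjective _ (coneTensor_injective hc0')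
  refine ⟨e.symm.trans e', fun B hB w w₁ hw => ?_⟩
  obtain ⟨L, hL⟩ := exists_mulVec_coneTensor hΓ hB
  obtain ⟨f, rfl⟩ := e.surjective w
  obtain ⟨g, rfl⟩ := e.surjective w₁
  have he : ∀ f, (e f : Option (X × Y) → ℂ) = coneTensor X c f := fun _ => rfl
  have he' : ∀ f, (e' f : Option (X × Y) → ℂ) = coneTensor X c' f := fun _ => rfl
  rw [he, he, hL c hc] at hw
  simp only [LinearEquiv.trans_apply, LinearEquiv.symm_apply_apply, he']
  rw [hL c' hc', coneTensor_injective hc0 hw]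

lemma hasEndpoint_map_coneTensor (hΓ : Γ.Connected) {c : Y → ℂ} (hc0 : c ≠ 0)
    {P : Submodule ℂ (X → ℂ)} (hP : ∃ f ∈ P, f x ≠ 0) :
    HasEndpoint (coneGraph Γ (⊥ : SimpleGraph Y) x) none (P.map (coneTensor X c)) 1 := by
  constructor
  · obtain ⟨f, hf, hfx⟩ := hP
    obtain ⟨y, hy⟩ := Function.ne_iff.1 hc0
    refine (Submodule.ne_bot_iff _).2 ⟨_, ⟨_, ⟨f, hf, rfl⟩, rfl⟩, fun h => ?_⟩
    rw [Matrix.mulVecLin_apply, dualIdempotent_succ_mulVec_coneTensor hΓ] at h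
    have := congrFun h (some (x, y))
    rw [coneTensor_some, dualIdempotent_mulVec_apply, if_pos SimpleGraph.dist_self] at this
    exact mul_ne_zero hfx hy this
  · rintro (_ | i) hi
    · refine absurd ?_ hi
      rw [eq_bot_iff]
      rintro _ ⟨_, ⟨f, hf, rfl⟩, rfl⟩
      exact dualIdempotent_zero_mulVec_coneTensor hΓ c f
    · omega

lemma isThin_map_coneTensor_levelModule (hΓ : Γ.Connected) (c : Y → ℂ) (ν : X → ℂ) :
    IsThin (coneGraph Γ (⊥ : SimpleGraph Y) x) none
      ((levelModule Γ x ν).map (coneTensor X c)) := by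
  intro i
  obtain ⟨u, hu⟩ : ∃ u, subconstituent (coneGraph Γ (⊥ : SimpleGraph Y) x) none
      ((levelModule Γ x ν).map (coneTensor X c)) i ≤ ℂ ∙ u := by
    -- Levels shift by one; at `i = 0` the truncated index is harmless, the subconstituent being
    -- zero.
    refine ⟨coneTensor X c (levelVec Γ x ν (i - 1)), ?_⟩
    rintro _ ⟨_, ⟨f, ⟨t, ht⟩, rfl⟩, rfl⟩
    rw [Matrix.mulVecLin_apply]
    rcases i with _ | i
    · rw [dualIdempotent_zero_mulVec_coneTensor hΓ]
      exact Submodule.zero_mem _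
    · rw [dualIdempotent_succ_mulVec_coneTensor hΓ, dualIdempotent_mulVec_levelModule ht, map_smul]
      exact Submodule.smul_mem _ _ (Submodule.mem_span_singleton_self _)
  exact (Submodule.finrank_mono hu).trans (finrank_span_le_card _ |>.trans (by simp))

/-- A module of endpoint `1` of the cone graph contains some `δ_x ⊗ c` with `c ≠ 0` of zero sum. -/
lemma exists_coneTensor_single_mem (hΓ : Γ.Connected) {W : Submodule ℂ (Option (X × Y) → ℂ)}
    (hW : IsTModule (coneGraph Γ (⊥ : SimpleGraph Y) x) none W)
    (hend : HasEndpoint (coneGraph Γ (⊥ : SimpleGraph Y) x) none W 1) :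
    ∃ c : Y → ℂ, c ≠ 0 ∧ ∑ y, c y = 0 ∧ coneTensor X c (Pi.single x 1) ∈ W := by
  classical
  obtain ⟨_, ⟨f, hf, rfl⟩, hu0⟩ := (Submodule.ne_bot_iff _).1 hend.1
  have huW := hW _ (dualIdempotent_mem 1) f hf
  rw [Matrix.mulVecLin_apply] at hu0
  have heq : (dualIdempotent (coneGraph Γ (⊥ : SimpleGraph Y) x) none 1).mulVec f =
      coneTensor X (fun y => f (some (x, y))) (Pi.single x 1) := by
    ext (_ | ⟨a, y⟩)
    · simp [dualIdempotent_mulVec_apply]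
    · rw [dualIdempotent_mulVec_apply, coneGraph_dist_none_some hΓ, coneTensor_some]
      by_cases ha : a = x
      · subst ha
        simp
      · have : Γ.dist x a ≠ 0 := fun h => ha (hΓ.dist_eq_zero_iff.1 h).symm
        simp [ha, this]
  rw [heq] at huW hu0
  refine ⟨_, fun h => hu0 ?_, ?_, huW⟩
  · rw [h]
    ext (_ | ⟨a, y⟩) <;> simp
  -- Endpoint `1` forces every vector of `W` to vanish at `w`; for the adjacency image of `δ_x ⊗ c`
  -- that entry is `∑ c`.
  · have hbot : subconstituent (coneGraph Γ (⊥ : SimpleGraph Y) x) none W 0 = ⊥ := by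
      by_contra h
      exact absurd (hend.2 h) (by omega)
    have h0 := Submodule.mem_map_of_mem
      (f := (dualIdempotent (coneGraph Γ (⊥ : SimpleGraph Y) x) none 0).mulVecLin)
      (hW _ adjMat_mem _ huW)
    rw [← subconstituent, hbot, Submodule.mem_bot] at h0
    have := congrFun h0 none
    rw [Matrix.mulVecLin_apply, dualIdempotent_mulVec_apply, if_pos SimpleGraph.dist_self,
      adjMat_mulVec_apply, Fintype.sum_option, Fintype.sum_prod_type, Finset.sum_eq_single x] at this
    · simpa using this
    · intro b _ hb
      simp [hb]
    · simp

variable {ν : X → ℂ} {k : ℕ → ℕ → ℂ}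

lemma IsLevelWeight.exists_eq_map_coneTensor (hΓ : Γ.Connected) (h : IsLevelWeight Γ x ν k)
    {W : Submodule ℂ (Option (X × Y) → ℂ)}
    (hW : IsIrreducibleTModule (coneGraph Γ (⊥ : SimpleGraph Y) x) none W)
    (hend : HasEndpoint (coneGraph Γ (⊥ : SimpleGraph Y) x) none W 1) :
    ∃ c : Y → ℂ, c ≠ 0 ∧ ∑ y, c y = 0 ∧ (levelModule Γ x ν).map (coneTensor X c) = W := by
  obtain ⟨c, hc0, hc, hmem⟩ := exists_coneTensor_single_mem hΓ hW.1 hend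
  refine ⟨c, hc0, hc, ?_⟩
  have hP := h.isIrreducibleTModule_levelModule hΓ
  have hsingle : (Pi.single x 1 : X → ℂ) ∈ levelModule Γ x ν := by
    refine ⟨fun i => if i = 0 then (ν x)⁻¹ else 0, fun a => ?_⟩
    by_cases ha : a = x
    · subst ha
      simp [h.ne_zero]
    · have : Γ.dist x a ≠ 0 := fun h => ha (hΓ.dist_eq_zero_iff.1 h).symm
      simp [ha, this]
  have hle : levelModule Γ x ν ≤ W.comap (coneTensor X c) := by
    -- The intersection is a submodule of the irreducible level module and contains `δ_x`, hence is
    -- everything.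
    rw [← inf_eq_left]
    refine (hP.2.2 _ (hP.1.inf (hW.1.comap_coneTensor hΓ hc)) inf_le_left).resolve_left ?_
    exact (Submodule.ne_bot_iff _).2 ⟨_, ⟨hsingle, hmem⟩, by simp⟩
  have hirr := hP.map_coneTensor (Y := Y) hΓ hc hc0
  exact (hW.2.2 _ hirr.1 (Submodule.map_le_iff_le_comap.2 hle)).resolve_left hirr.2.1

theorem IsLevelWeight.existsUnique_endpoint_one [Nontrivial Y] (hΓ : Γ.Connected)
    (h : IsLevelWeight Γ x ν k) :
    ∃ W : Submodule ℂ (Option (X × Y) → ℂ),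
      (IsIrreducibleTModule (coneGraph Γ (⊥ : SimpleGraph Y) x) none W ∧
        HasEndpoint (coneGraph Γ (⊥ : SimpleGraph Y) x) none W 1) ∧
      IsThin (coneGraph Γ (⊥ : SimpleGraph Y) x) none W ∧
      ∀ W' : Submodule ℂ (Option (X × Y) → ℂ),
        IsIrreducibleTModule (coneGraph Γ (⊥ : SimpleGraph Y) x) none W' →
        HasEndpoint (coneGraph Γ (⊥ : SimpleGraph Y) x) none W' 1 →
        TIsomorphic (coneGraph Γ (⊥ : SimpleGraph Y) x) none W W' := by
  obtain ⟨y, z, hyz⟩ := exists_pair_ne Y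
  obtain ⟨c, hc0, hc⟩ : ∃ c : Y → ℂ, c ≠ 0 ∧ ∑ y, c y = 0 :=
    -- A nonzero zero-sum vector exists because `Y` has two distinct elements.
    ⟨Pi.single y 1 - Pi.single z 1, fun h => by simpa [hyz] using congrFun h y, by simp⟩
  refine ⟨(levelModule Γ x ν).map (coneTensor X c),
    ⟨(h.isIrreducibleTModule_levelModule hΓ).map_coneTensor hΓ hc hc0,
      hasEndpoint_map_coneTensor hΓ hc0 ⟨ν, ⟨1, by simp⟩, h.ne_zero x⟩⟩,
    isThin_map_coneTensor_levelModule hΓ c ν, fun W' hW' hend => ?_⟩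
  obtain ⟨c', hc0', hc', rfl⟩ := h.exists_eq_map_coneTensor hΓ hW' hend
  exact tIsomorphic_map_coneTensor hΓ hc hc0 hc' hc0' _

end ConeModule

end TerwilligerGraph

open TerwilligerGraph in
theorem proposition7p3 {X : Type*} {Y : Type*} [Fintype X] [DecidableEq X]
    [Fintype Y] [DecidableEq Y] (Γ : SimpleGraph X) (S : SimpleGraph Y) (x : X)
    (hconn : Γ.Connected) (hpdr : IsPseudoDistanceRegularAround Γ x)
    (n : ℕ) (hn : 2 ≤ n) (hS : Nonempty (S ≃g (⊥ : SimpleGraph (Fin n)))) :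
    (∃ W : Submodule ℂ (Option (X × Y) → ℂ),
      (IsIrreducibleTModule (coneGraph Γ S x) none W ∧
        HasEndpoint (coneGraph Γ S x) none W 1) ∧
      IsThin (coneGraph Γ S x) none W ∧
      ∀ W' : Submodule ℂ (Option (X × Y) → ℂ),
        IsIrreducibleTModule (coneGraph Γ S x) none W' →
        HasEndpoint (coneGraph Γ S x) none W' 1 →
        TIsomorphic (coneGraph Γ S x) none W W') ∧
    (∃ α β : ℕ → ℂ, TrivialWalkScalars Γ x α β) ∧
    (∀ α β : ℕ → ℂ, TrivialWalkScalars Γ x α β →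
      WalkConditions (coneGraph Γ S x) none
        (fun i => α (i - 1)) (fun _ => 0) (fun i => β (i - 1)) (fun _ => 0)) := by
  obtain ⟨e⟩ := hS
  obtain rfl : S = ⊥ := by
    ext a b
    exact ⟨fun h => e.map_adj_iff.2 h, False.elim⟩
  have : Nontrivial (Fin n) := Fin.nontrivial_iff_two_le.2 hn
  have : Nontrivial Y := e.toEquiv.nontrivial
  obtain ⟨ν, k, h⟩ := hpdr.exists_isLevelWeight hconn
  exact ⟨h.existsUnique_endpoint_one hconn, h.exists_trivialWalkScalars hconn,
    fun _ _ hαβ => hαβ.walkConditions_coneGraph hconn⟩
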